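/- A diffeological vector space is a real vector space $V$ with a diffeology for which addition $V\times V\to V$ and scalar multiplication $\mathbb{R}\times V\to V$ are smooth. Let $L^\infty(V)$ denote the set of smooth linear functionals $V\to\mathbb{R}$. We say that $V$ is: - pre-convenient if the plots of $V$ are exactly the maps $p\colon U\to V$, with $U$ open in some $\mathbb{R}^n$, such that $l\circ p$ is smooth for all $l\in L^\infty(V)$; - linearly separated if $L^\infty(V)$ separates the points of $V$; - convenient if it is pre-convenient and linearly separated, and every smooth curve $c\colon\mathbb{R}\to V$ is infinitely weakly differentiable. Here $d\colon\mathbb{R}\to V$ is a weak derivative of $c$ if, for every $l\in L^\infty(V)$, the function $l\circ c$ is differentiable with derivative $l\circ d$; and $c$ is infinitely weakly differentiable if there are curves $c=c_0,c_1,c_2,\dots$ such that $c_{k+1}$ is a weak derivative of $c_k$ for all $k\ge 0$. For a diffeological space $X$, let $TX$ be the diffeological tangent bundle, i.e. the value at $X$ of the left Kan extension of $U\mapsto U\times\mathbb{R}^n$ ($U\subseteq\mathbb{R}^n$ open, $f\mapsto((u,v)\mapsto(f(u),D_uf(v)))$) along the inclusion of open subsets of Cartesian spaces into diffeological spaces.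 Explicitly, $TX$ is the quotient of $\coprod_{p\colon U\to X}U\times\mathbb{R}^n$ (over all plots $p$ of $X$) by the equivalence relation generated by $(p'\circ f,u,v)\sim(p',f(u),D_uf(v))$ for smooth $f\colon U\to U'$ and plots $p'\colon U'\to X$, with the quotient diffeology. Write $p_*(u,v)$ for the class of $(u,v)$ in the summand of $p$. We say that $V$ is tangent-stable if the map $$\ell\colon V\times V\to TV,\qquad \ell(u,v)=[t\mapsto u+tv]_*(0,1)$$ is an isomorphism of diffeological spaces. **Theorem.** A pre-convenient and linearly separated diffeological vector space is convenient if and only if it is tangent-stable. -/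

import Mathlib

open scoped ContDiff

noncomputable section

namespace Diffeology

/-! ### Product diffeology and diffeological vector spaces -/

/-- The product diffeology: a map into `X × Y` is a plot iff both of its components are plots. -/
instance instDiffeologicalSpaceProd {X Y : Type*} [DiffeologicalSpace X] [DiffeologicalSpace Y] :
    DiffeologicalSpace (X × Y) where
  plots n := {p | IsPlot (fun x : EuclideanSpace ℝ (Fin n) => (p x).1) ∧
    IsPlot (fun x : EuclideanSpace ℝ (Fin n) => (p x).2)}
  constant_plots _ := ⟨isPlot_const, isPlot_const⟩
  plot_reparam hp hf := ⟨isPlot_reparam hp.1 hf, isPlot_reparam hp.2 hf⟩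
  locality h := by
    refine ⟨DiffeologicalSpace.locality fun x => ?_, DiffeologicalSpace.locality fun x => ?_⟩
    · obtain ⟨u, hu, hx, H⟩ := h x
      exact ⟨u, hu, hx, fun hfu hf => (H hfu hf).1⟩
    · obtain ⟨u, hu, hx, H⟩ := h x
      exact ⟨u, hu, hx, fun hfu hf => (H hfu hf).2⟩

/-- A diffeological vector space: a real vector space with a diffeology for which addition
`V × V → V` and scalar multiplication `ℝ × V → V` are smooth. -/
class DiffeologicalVectorSpace (V : Type*) [AddCommGroup V] [Module ℝ V]
    [DiffeologicalSpace V] : Prop where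
  dSmooth_add : DSmooth (fun x : V × V => x.1 + x.2)
  dSmooth_smul : DSmooth (fun x : ℝ × V => x.1 • x.2)

/-! ### The tangent functor

`DTangent X` is the left Kan extension, along the inclusion of open subsets of Cartesian spaces
into diffeological spaces, of the functor sending an open set `U ⊆ ℝⁿ` to `U × ℝⁿ`. It is computed
as the colimit over the category of all plots `p : U → X`. -/

/-- `p`, restricted to the open set `U ⊆ ℝⁿ`, is a plot `U → X`. Only the values on `U` matter. -/
def IsPlotOn {X : Type*} [DiffeologicalSpace X] {n : ℕ}
    (p : EuclideanSpace ℝ (Fin n) → X) (U : Set (EuclideanSpace ℝ (Fin n))) : Prop :=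
  ∀ (m : ℕ) (f : EuclideanSpace ℝ (Fin m) → EuclideanSpace ℝ (Fin n)),
    ContDiff ℝ ∞ f → (∀ x, f x ∈ U) → IsPlot (p ∘ f)

/-- An element `(u, v)` of the summand `U × ℝⁿ` indexed by the plot `p : U → X` in the
coproduct of all the `U × ℝⁿ`. -/
structure PlotVector (X : Type*) [DiffeologicalSpace X] where
  dim : ℕ
  dom : Set (EuclideanSpace ℝ (Fin dim))
  isOpen_dom : IsOpen dom
  plot : EuclideanSpace ℝ (Fin dim) → X
  isPlotOn : IsPlotOn plot dom
  pt : EuclideanSpace ℝ (Fin dim)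
  pt_mem : pt ∈ dom
  vec : EuclideanSpace ℝ (Fin dim)

/-- The generating relation of the colimit: `f : U → U'` is a smooth map with `p' ∘ f = p` on `U`,
and the tangent map of `f` sends `(u, v)` to `(u', v')`. -/
def PlotVector.Step {X : Type*} [DiffeologicalSpace X] (a b : PlotVector X) : Prop :=
  ∃ f : EuclideanSpace ℝ (Fin a.dim) → EuclideanSpace ℝ (Fin b.dim),
    ContDiffOn ℝ ∞ f a.dom ∧ Set.MapsTo f a.dom b.dom ∧
    (∀ x ∈ a.dom, b.plot (f x) = a.plot x) ∧
    f a.pt = b.pt ∧ fderiv ℝ f a.pt a.vec = b.vec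

/-- The (internal) tangent bundle `TX` of a diffeological space, the quotient of the coproduct by
the equivalence relation generated by `PlotVector.Step`. -/
def DTangent (X : Type*) [DiffeologicalSpace X] : Type _ :=
  Quot (PlotVector.Step (X := X))

/-- The element `p_*(u, v)` of `TX`. -/
def DTangent.mk {X : Type*} [DiffeologicalSpace X] {n : ℕ}
    {U : Set (EuclideanSpace ℝ (Fin n))} (hU : IsOpen U)
    {p : EuclideanSpace ℝ (Fin n) → X} (hp : IsPlotOn p U)
    {u : EuclideanSpace ℝ (Fin n)} (hu : u ∈ U) (v : EuclideanSpace ℝ (Fin n)) : DTangent X :=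
  Quot.mk _ ⟨n, U, hU, p, hp, u, hu, v⟩

/-- The colimit diffeology on `TX`: the finest diffeology for which the maps
`U × ℝⁿ → TX, (u, v) ↦ p_*(u, v)`, are smooth for all plots `p : U → X`, i.e. the one generated
by the composites of these maps with the smooth maps `(a, b) : ℝᵐ → U × ℝⁿ`. -/
instance instDiffeologicalSpaceDTangent {X : Type*} [DiffeologicalSpace X] :
    DiffeologicalSpace (DTangent X) :=
  DiffeologicalSpace.generateFrom
    {q | ∃ (n : ℕ) (U : Set (EuclideanSpace ℝ (Fin n))) (hU : IsOpen U)
        (p : EuclideanSpace ℝ (Fin n) → X) (hp : IsPlotOn p U)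
        (a b : EuclideanSpace ℝ (Fin q.1) → EuclideanSpace ℝ (Fin n)) (ha : ∀ r, a r ∈ U),
      ContDiff ℝ ∞ a ∧ ContDiff ℝ ∞ b ∧ q.2 = fun r => DTangent.mk hU hp (ha r) (b r)}

theorem isPlotOn_curve {X : Type*} [DiffeologicalSpace X] {γ : ℝ → X} (hγ : DSmooth γ) :
    IsPlotOn (fun x : EuclideanSpace ℝ (Fin 1) => γ (x 0)) Set.univ := by
  intro m f hf _
  refine hγ m (fun x => f x 0) (ContDiff.isPlot ?_)
  fun_prop

/-- The map `∂ : C^∞(ℝ, X) → TX`, `γ ↦ γ_*(0, 1)`, where `ℝ` is regarded as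
`EuclideanSpace ℝ (Fin 1)`. -/
def curveTangent {X : Type*} [DiffeologicalSpace X] (γ : ℝ → X) (hγ : DSmooth γ) : DTangent X :=
  DTangent.mk isOpen_univ (isPlotOn_curve hγ) (Set.mem_univ 0) (EuclideanSpace.single 0 1)

/-- An isomorphism of diffeological spaces. -/
def IsDiffeomorphism {X Y : Type*} [DiffeologicalSpace X] [DiffeologicalSpace Y]
    (f : X → Y) : Prop :=
  DSmooth f ∧ ∃ g : Y → X, DSmooth g ∧ Function.LeftInverse g f ∧ Function.RightInverse g f

section VectorSpace

variable (V : Type*) [AddCommGroup V] [Module ℝ V] [DiffeologicalSpace V]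

theorem dSmooth_line {V : Type*} [AddCommGroup V] [Module ℝ V] [DiffeologicalSpace V]
    [DiffeologicalVectorSpace V] (u v : V) : DSmooth (fun t : ℝ => u + t • v) := by
  intro n p hp
  have h1 : IsPlot (fun x => p x • v) :=
    DiffeologicalVectorSpace.dSmooth_smul n (fun x => (p x, v)) ⟨hp, isPlot_const⟩
  exact DiffeologicalVectorSpace.dSmooth_add n (fun x => (u, p x • v)) ⟨isPlot_const, h1⟩

/-- The natural map `ℓ : V × V → TV`, `(u, v) ↦ ∂[t ↦ u + t v]`. -/
def lineTangent [DiffeologicalVectorSpace V] (x : V × V) : DTangent V :=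
  curveTangent (fun t : ℝ => x.1 + t • x.2) (dSmooth_line x.1 x.2)

/-- `V` is tangent-stable if `ℓ : V × V → TV` is an isomorphism of diffeological spaces. -/
def IsTangentStable [DiffeologicalVectorSpace V] : Prop :=
  IsDiffeomorphism (lineTangent V)

/-! ### Convenience -/

/-- `L^∞(V)`: the smooth linear functionals on `V`. -/
def smoothDual : Set (V →ₗ[ℝ] ℝ) := {l | DSmooth l}

/-- The diffeology `Π F` determined by a set `F` of real-valued functions: `p` is a plot iff
`f ∘ p` is smooth for every `f ∈ F`. -/
@[reducible] def determinedBy {X : Type*} (F : Set (X → ℝ)) : DiffeologicalSpace X where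
  plots n := {p | ∀ f ∈ F, IsPlot (fun x : EuclideanSpace ℝ (Fin n) => f (p x))}
  constant_plots _ := fun _ _ => isPlot_const
  plot_reparam hp hg := fun f hf => isPlot_reparam (hp f hf) hg
  locality h := by
    intro f hf
    refine DiffeologicalSpace.locality fun x => ?_
    obtain ⟨u, hu, hx, H⟩ := h x
    exact ⟨u, hu, hx, fun hgu hg => H hgu hg f hf⟩

/-- `V` is pre-convenient if its diffeology is the one determined by `L^∞(V)`. -/
def IsPreConvenient (V : Type*) [AddCommGroup V] [Module ℝ V] [D : DiffeologicalSpace V] : Prop :=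
  D = determinedBy {f : V → ℝ | ∃ l ∈ smoothDual V, f = l}

/-- `V` is linearly separated if `L^∞(V)` separates points. -/
def IsLinearlySeparated : Prop :=
  ∀ u v : V, u ≠ v → ∃ l ∈ smoothDual V, l u ≠ l v

variable {V} in
/-- `d` is a weak derivative of the curve `c`. -/
def IsWeakDeriv (c d : ℝ → V) : Prop :=
  ∀ l ∈ smoothDual V, ∀ t : ℝ, HasDerivAt (fun s => l (c s)) (l (d t)) t

variable {V} in
/-- `c` has weak derivatives of all orders. -/
def IsInfinitelyWeaklyDifferentiable (c : ℝ → V) : Prop :=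
  ∃ d : ℕ → ℝ → V, d 0 = c ∧ ∀ k, IsWeakDeriv (d k) (d (k + 1))

/-- `V` is convenient if it is pre-convenient, linearly separated, and every smooth curve in `V`
is infinitely weakly differentiable. -/
def IsConvenient : Prop :=
  IsPreConvenient V ∧ IsLinearlySeparated V ∧
    ∀ c : ℝ → V, DSmooth c → IsInfinitelyWeaklyDifferentiable c

end VectorSpace

end Diffeology

end

/-! A smooth functional `l` induces a map `TV → ℝ × ℝ` sending `ℓ(u, v)` to `(l u, l v)`. These maps
make `ℓ` injective when functionals separate points, and, with pre-convenience, make its inverse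
smooth once it exists.

If `V` is convenient, every tangent vector comes from a smooth curve `c` (`exists_curveTangent_eq`),
and `c(t) = c(0) + t v + t² e(t)` with `e` smooth (`exists_taylor`, via Hadamard's lemma after
applying each `l`). In the plot `(t, s) ↦ c(0) + t v + s e(t)`, the paths `(t, t²)` and `(t, 0)`
have the same velocity at `0`, so `c` and its tangent line define the same tangent vector, and `ℓ`
is onto.

Conversely, applying `ℓ⁻¹` to `t ↦ c_*(t, 1)` and taking the second component gives a smooth weak
derivative of `c`; iterate. -/

section Hadamard

/-! ### Hadamard's lemma and second-order slopes -/

open MeasureTheory Set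

theorem hasDerivAt_integral_pow_mul_comp_mul {g : ℝ → ℝ} (hg : ContDiff ℝ ∞ g) (n : ℕ) (t : ℝ) :
    HasDerivAt (fun t => ∫ s in (0 : ℝ)..1, s ^ n * g (t * s))
      (∫ s in (0 : ℝ)..1, s ^ (n + 1) * deriv g (t * s)) t := by
  have hg' : Continuous (deriv g) := hg.continuous_deriv (by simp)
  -- This interval contains every `x * s` with `|x - t| < 1` and `0 < s ≤ 1`, so `C` dominates the
  -- differentiated integrand.
  obtain ⟨C, hC⟩ := (isCompact_Icc (a := -(|t| + 1)) (b := |t| + 1)).exists_bound_of_continuousOn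
    hg'.continuousOn
  have hcont := hg.continuous
  refine (intervalIntegral.hasDerivAt_integral_of_dominated_loc_of_deriv_le
    (s := Metric.ball t 1) (bound := fun _ => C)
    (F := fun t s => s ^ n * g (t * s)) (F' := fun t s => s ^ (n + 1) * deriv g (t * s))
    (Metric.ball_mem_nhds t one_pos) ?_ ?_ ?_ ?_ ?_ ?_).2
  · exact Filter.Eventually.of_forall fun x =>
      (by fun_prop : Continuous fun s => s ^ n * g (x * s)).aestronglyMeasurable
  · exact (by fun_prop : Continuous fun s => s ^ n * g (t * s)).intervalIntegrable _ _
  · exact (by fun_prop : Continuous fun s => s ^ (n + 1) * deriv g (t * s)).aestronglyMeasurable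
  · refine Filter.Eventually.of_forall fun s hs x hx => ?_
    rw [uIoc_of_le zero_le_one] at hs
    rw [Metric.mem_ball, Real.dist_eq] at hx
    have hx' : |x| ≤ |t| + 1 := by
      have := abs_sub_abs_le_abs_sub x t
      linarith
    have hxs : |x * s| ≤ |t| + 1 := by
      rw [abs_mul, abs_of_pos hs.1]
      exact (mul_le_of_le_one_right (abs_nonneg _) hs.2).trans hx'
    rw [norm_mul, norm_pow, Real.norm_of_nonneg hs.1.le]
    exact (mul_le_of_le_one_left (norm_nonneg _) (pow_le_one₀ hs.1.le hs.2)).trans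
      (hC _ (abs_le.1 hxs))
  · exact intervalIntegrable_const
  · refine Filter.Eventually.of_forall fun s _ x _ => ?_
    have h1 : HasDerivAt g (deriv g (x * s)) (x * s) :=
      (hg.differentiable (by simp) _).hasDerivAt
    have h2 := (h1.comp x (hasDerivAt_mul_const s)).const_mul (s ^ n)
    convert! h2 using 1
    ring

/-- The derivative is an integral of the same shape, with `g'` and `n + 1`; the weight `s ^ n` is
there so that the induction closes. -/
theorem contDiff_integral_pow_mul_comp_mul {g : ℝ → ℝ} (hg : ContDiff ℝ ∞ g) (n : ℕ) :
    ContDiff ℝ ∞ fun t => ∫ s in (0 : ℝ)..1, s ^ n * g (t * s) := by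
  refine contDiff_infty.2 fun k => ?_
  induction k generalizing g n with
  | zero =>
    refine contDiff_zero.2 (continuous_iff_continuousAt.2 fun t => ?_)
    exact (hasDerivAt_integral_pow_mul_comp_mul hg n t).continuousAt
  | succ k ih =>
    refine (contDiff_succ_iff_deriv (n := k)).2
      ⟨fun t => (hasDerivAt_integral_pow_mul_comp_mul hg n t).differentiableAt, by simp, ?_⟩
    rw [funext fun t => (hasDerivAt_integral_pow_mul_comp_mul hg n t).deriv]
    exact ih (contDiff_infty_iff_deriv.1 hg).2 (n + 1)

/-- Hadamard's lemma in one variable. -/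
theorem ContDiff.dslope_zero {g : ℝ → ℝ} (hg : ContDiff ℝ ∞ g) : ContDiff ℝ ∞ (dslope g 0) := by
  convert! contDiff_integral_pow_mul_comp_mul (contDiff_infty_iff_deriv.1 hg).2 0 using 1
  funext t
  rcases eq_or_ne t 0 with rfl | ht
  · simp
  · have h := intervalIntegral.smul_integral_comp_mul_left (a := 0) (b := 1) (deriv g) t
    rw [intervalIntegral.integral_deriv_eq_sub (fun x _ => hg.differentiable (by simp) x)
      ((hg.continuous_deriv (by simp)).intervalIntegrable _ _)] at h
    rw [dslope_of_ne _ ht, slope_def_field]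
    simp only [smul_eq_mul, mul_one, mul_zero] at h
    simp only [← h, sub_zero, pow_zero, one_mul, mul_div_cancel_left₀ _ ht]

theorem eq_add_mul_deriv_add_sq_mul_dslope_dslope (g : ℝ → ℝ) (t : ℝ) :
    g t = g 0 + t * deriv g 0 + t ^ 2 * dslope (dslope g 0) 0 t := by
  have h1 := sub_smul_dslope g 0 t
  have h2 := sub_smul_dslope (dslope g 0) 0 t
  rw [dslope_same, sub_zero, smul_eq_mul] at h2
  rw [sub_zero, smul_eq_mul] at h1
  linear_combination -h1 - t * h2

/-- With `g = g 0 + t h` one has `g' = h + t h'`, whose derivative at `0` is `2 h'(0)`. -/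
theorem dslope_dslope_zero_of_hasDerivAt {g : ℝ → ℝ} (hg : ContDiff ℝ ∞ g) {a : ℝ}
    (ha : HasDerivAt (deriv g) a 0) : dslope (dslope g 0) 0 0 = 2⁻¹ * a := by
  have hd : ContDiff ℝ ∞ (dslope g 0) := hg.dslope_zero
  have h (t : ℝ) : HasDerivAt (dslope g 0) (deriv (dslope g 0) t) t :=
    (hd.differentiable (by simp) t).hasDerivAt
  have hg' : deriv g = fun t => dslope g 0 t + t * deriv (dslope g 0) t := by
    funext t
    have h1 := ((hasDerivAt_id t).mul (h t)).const_add (g 0)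
    have h2 : g = fun t => g 0 + ((id : ℝ → ℝ) * dslope g 0) t := by
      funext s
      have := sub_smul_dslope g 0 s
      simp only [sub_zero, smul_eq_mul] at this
      simp [this]
    conv_lhs => rw [h2]
    simpa only [id, one_mul] using h1.deriv
  have hdd : HasDerivAt (deriv (dslope g 0)) (deriv (deriv (dslope g 0)) 0) 0 :=
    (((contDiff_infty_iff_deriv.1 hd).2).differentiable (by simp) 0).hasDerivAt
  have h3 := (h 0).add ((hasDerivAt_id (0 : ℝ)).mul hdd)
  have h4 := ha.unique (by rw [hg']; exact h3)
  rw [dslope_same]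
  simp only [id, one_mul, zero_mul, add_zero] at h4
  linarith

end Hadamard

namespace Diffeology

/-! ### Plots and smooth functionals -/

section Plots

/-- `IsPlotOn` only tests maps from a whole `ℝᵐ`, so each ball in `U` is reparametrized by a
diffeomorphism from `ℝⁿ`, which is then undone. -/
theorem IsPlotOn.contDiffOn {X : Type*} [DiffeologicalSpace X] {n : ℕ}
    {p : EuclideanSpace ℝ (Fin n) → X} {U : Set (EuclideanSpace ℝ (Fin n))} (hU : IsOpen U)
    (hp : IsPlotOn p U) {f : X → ℝ} (hf : DSmooth f) : ContDiffOn ℝ ∞ (f ∘ p) U := by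
  intro x hx
  obtain ⟨ε, hε, hε'⟩ := Metric.isOpen_iff.1 hU x hx
  have h1 : ContDiff ℝ ∞ (f ∘ p ∘ OpenPartialHomeomorph.univBall x ε) := by
    refine IsPlot.contDiff (hf _ _ (hp n _ OpenPartialHomeomorph.contDiff_univBall fun y => hε' ?_))
    have := (OpenPartialHomeomorph.univBall x ε).map_source (x := y)
    rw [OpenPartialHomeomorph.univBall_target x hε] at this
    exact this (by simp)
  have h2 := h1.comp_contDiffOn
    (OpenPartialHomeomorph.contDiffOn_univBall_symm (c := x) (r := ε) (n := ⊤))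
  have h3 : ContDiffOn ℝ ∞ (f ∘ p) (Metric.ball x ε) := by
    refine h2.congr fun y hy => ?_
    have := (OpenPartialHomeomorph.univBall x ε).right_inv (x := y)
      (by rwa [OpenPartialHomeomorph.univBall_target x hε])
    simp [this]
  exact ((h3 x (Metric.mem_ball_self hε)).contDiffAt
    (Metric.ball_mem_nhds x hε)).contDiffWithinAt

theorem IsPlot.isPlotOn {X : Type*} [DiffeologicalSpace X] {n : ℕ}
    {p : EuclideanSpace ℝ (Fin n) → X} (hp : IsPlot p) (U : Set (EuclideanSpace ℝ (Fin n))) :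
    IsPlotOn p U :=
  fun _ _ hf _ => isPlot_reparam hp hf

variable {V : Type*} [AddCommGroup V] [Module ℝ V] [DiffeologicalSpace V]

theorem IsPlot.add [DiffeologicalVectorSpace V] {n : ℕ} {p q : EuclideanSpace ℝ (Fin n) → V}
    (hp : IsPlot p) (hq : IsPlot q) : IsPlot fun x => p x + q x :=
  DiffeologicalVectorSpace.dSmooth_add n (fun x => (p x, q x)) ⟨hp, hq⟩

theorem IsPlot.smul [DiffeologicalVectorSpace V] {n : ℕ} {a : EuclideanSpace ℝ (Fin n) → ℝ}
    {p : EuclideanSpace ℝ (Fin n) → V} (ha : ContDiff ℝ ∞ a) (hp : IsPlot p) :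
    IsPlot fun x => a x • p x :=
  DiffeologicalVectorSpace.dSmooth_smul n (fun x => (a x, p x)) ⟨ha.isPlot, hp⟩

theorem IsPreConvenient.isPlot_iff (h : IsPreConvenient V) {n : ℕ}
    {p : EuclideanSpace ℝ (Fin n) → V} :
    IsPlot p ↔ ∀ l ∈ smoothDual V, ContDiff ℝ ∞ fun x => l (p x) := by
  have h' := congrArg (fun D : DiffeologicalSpace V => @IsPlot V D n p) h
  refine (iff_of_eq h').trans ⟨fun H l hl => IsPlot.contDiff (H _ ⟨l, hl, rfl⟩), ?_⟩
  rintro H _ ⟨l, hl, rfl⟩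
  exact (H l hl).isPlot

theorem IsPreConvenient.dSmooth_of_forall (h : IsPreConvenient V) {c : ℝ → V}
    (hc : ∀ l ∈ smoothDual V, ContDiff ℝ ∞ fun x => l (c x)) : DSmooth c :=
  fun _ _ hp => h.isPlot_iff.2 fun l hl => (hc l hl).comp hp.contDiff

theorem IsLinearlySeparated.eq_of_forall (h : IsLinearlySeparated V) {u v : V}
    (huv : ∀ l ∈ smoothDual V, l u = l v) : u = v := by
  by_contra hne
  obtain ⟨l, hl, hl'⟩ := h u v hne
  exact hl' (huv l hl)

theorem DSmooth.contDiff_dual {c : ℝ → V} (hc : DSmooth c) {l : V →ₗ[ℝ] ℝ}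
    (hl : l ∈ smoothDual V) : ContDiff ℝ ∞ fun t => l (c t) :=
  DSmooth.contDiff (DSmooth.comp (show DSmooth l from hl) hc)

end Plots

/-! ### Tangent vectors, functions on `TX`, and curves -/

section Tangent

variable {X : Type*} [DiffeologicalSpace X]

/-- The tangent map `TX → ℝ × ℝ` of a smooth function on `X`. -/
noncomputable def tangentMap (f : X → ℝ) (hf : DSmooth f) : DTangent X → ℝ × ℝ :=
  Quot.lift (fun a => (f (a.plot a.pt), fderiv ℝ (f ∘ a.plot) a.pt a.vec)) (by
    rintro a b ⟨g, hg, hmaps, hgp, hpt, hvec⟩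
    have h1 : f ∘ a.plot =ᶠ[nhds a.pt] (f ∘ b.plot) ∘ g := by
      filter_upwards [a.isOpen_dom.mem_nhds a.pt_mem] with x hx
      simp [hgp x hx]
    have h2 : DifferentiableAt ℝ g a.pt :=
      (hg.contDiffAt (a.isOpen_dom.mem_nhds a.pt_mem)).differentiableAt (by simp)
    have h3 : DifferentiableAt ℝ (f ∘ b.plot) (g a.pt) := by
      rw [hpt]
      exact ((b.isPlotOn.contDiffOn b.isOpen_dom hf).contDiffAt
        (b.isOpen_dom.mem_nhds b.pt_mem)).differentiableAt (by simp)
    refine Prod.ext ?_ ?_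
    · simp only
      rw [← hgp _ a.pt_mem, hpt]
    · simp only
      rw [h1.fderiv_eq, fderiv_comp _ h3 h2, ← hvec, hpt]
      rfl)

theorem tangentMap_mk {f : X → ℝ} (hf : DSmooth f) {n : ℕ}
    {U : Set (EuclideanSpace ℝ (Fin n))} (hU : IsOpen U)
    {p : EuclideanSpace ℝ (Fin n) → X} (hp : IsPlotOn p U)
    {u : EuclideanSpace ℝ (Fin n)} (hu : u ∈ U) (v : EuclideanSpace ℝ (Fin n)) :
    tangentMap f hf (DTangent.mk hU hp hu v) = (f (p u), fderiv ℝ (f ∘ p) u v) :=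
  rfl

theorem fderiv_comp_coord {E : Type*} [NormedAddCommGroup E] [NormedSpace ℝ E] {φ : ℝ → E}
    {v : E} {x : EuclideanSpace ℝ (Fin 1)} (hφ : HasDerivAt φ v (x 0)) :
    fderiv ℝ (fun y : EuclideanSpace ℝ (Fin 1) => φ (y 0)) x (EuclideanSpace.single 0 1) = v := by
  have h1 : HasFDerivAt (fun y : EuclideanSpace ℝ (Fin 1) => y 0)
      (EuclideanSpace.proj 0 : EuclideanSpace ℝ (Fin 1) →L[ℝ] ℝ) x :=
    (EuclideanSpace.proj (0 : Fin 1) : EuclideanSpace ℝ (Fin 1) →L[ℝ] ℝ).hasFDerivAt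
  have h2 := hφ.hasFDerivAt.comp x h1
  have h3 := h2.fderiv
  simp only [Function.comp_def] at h3
  rw [h3]
  simp

theorem tangentMap_mk_curve {f : X → ℝ} (hf : DSmooth f) {γ : ℝ → X} (hγ : DSmooth γ)
    (x : EuclideanSpace ℝ (Fin 1)) :
    tangentMap f hf (DTangent.mk isOpen_univ (isPlotOn_curve hγ) (Set.mem_univ x)
      (EuclideanSpace.single 0 1)) = (f (γ (x 0)), deriv (fun t => f (γ t)) (x 0)) := by
  rw [tangentMap_mk]
  refine Prod.ext rfl ?_
  have h : HasDerivAt (fun t => f (γ t)) (deriv (fun t => f (γ t)) (x 0)) (x 0) :=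
    ((DSmooth.contDiff (DSmooth.comp hf hγ)).differentiable (by simp) _).hasDerivAt
  exact fderiv_comp_coord h

theorem curveTangent_eq_mk {γ : ℝ → X} (hγ : DSmooth γ) {n : ℕ}
    {U : Set (EuclideanSpace ℝ (Fin n))} (hU : IsOpen U)
    {p : EuclideanSpace ℝ (Fin n) → X} (hp : IsPlotOn p U)
    {u : EuclideanSpace ℝ (Fin n)} (hu : u ∈ U) (v : EuclideanSpace ℝ (Fin n))
    {φ : ℝ → EuclideanSpace ℝ (Fin n)} (hφ : ContDiff ℝ ∞ φ) (hφU : ∀ t, φ t ∈ U)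
    (hpφ : ∀ t, p (φ t) = γ t) (hφ0 : φ 0 = u) (hφv : HasDerivAt φ v 0) :
    curveTangent γ hγ = DTangent.mk hU hp hu v := by
  refine Quot.sound ⟨fun x => φ (x 0), ?_, fun x _ => hφU _, fun x _ => hpφ _, hφ0, ?_⟩
  · exact (hφ.comp (by fun_prop : ContDiff ℝ ∞ fun x : EuclideanSpace ℝ (Fin 1) => x 0)).contDiffOn
  · exact fderiv_comp_coord (by simpa using hφv)

theorem dSmooth_dTangent_of_mk {F : DTangent X → ℝ}
    (hF : ∀ (n : ℕ) (U : Set (EuclideanSpace ℝ (Fin n))) (hU : IsOpen U)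
      (p : EuclideanSpace ℝ (Fin n) → X) (hp : IsPlotOn p U) (m : ℕ)
      (a b : EuclideanSpace ℝ (Fin m) → EuclideanSpace ℝ (Fin n)) (ha : ∀ r, a r ∈ U),
      ContDiff ℝ ∞ a → ContDiff ℝ ∞ b →
        ContDiff ℝ ∞ fun r => F (DTangent.mk hU hp (ha r) (b r))) : DSmooth F := by
  intro m q hq
  -- The generated diffeology is the finest containing its generators, so it suffices that these are
  -- plots for the diffeology determined by `F`.
  refine hq (determinedBy {F}) ?_ F rfl
  rintro ⟨k, q⟩ ⟨n, U, hU, p, hp, a, b, ha, ha', hb', hqe⟩ F' rfl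
  have h := (hF n U hU p hp k a b ha ha' hb').isPlot
  simp only at hqe
  simpa only [hqe] using h

theorem dSmooth_tangentMap_fst {f : X → ℝ} (hf : DSmooth f) :
    DSmooth fun τ => (tangentMap f hf τ).1 :=
  dSmooth_dTangent_of_mk fun _ _ hU _ hp _ _ _ ha ha' _ =>
    (hp.contDiffOn hU hf).comp_contDiff ha' ha

theorem dSmooth_tangentMap_snd {f : X → ℝ} (hf : DSmooth f) :
    DSmooth fun τ => (tangentMap f hf τ).2 :=
  dSmooth_dTangent_of_mk fun _ _ hU _ hp _ _ _ ha ha' hb' =>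
    (((hp.contDiffOn hU hf).fderiv_of_isOpen hU (m := ∞) (by simp)).comp_contDiff ha' ha).clm_apply
      hb'

theorem exists_curveTangent_eq (τ : DTangent X) :
    ∃ (γ : ℝ → X) (hγ : DSmooth γ), curveTangent γ hγ = τ := by
  obtain ⟨n, U, hU, p, hp, u, hu, v⟩ := τ
  obtain ⟨ε, hε, hεU⟩ := Metric.isOpen_iff.1 hU u hu
  set δ := ε / (‖v‖ + 1) with hδ
  have hδ0 : 0 < δ := by positivity
  -- A straight line could leave `U`; the sine keeps the curve in the `ε`-ball with velocity `v` at
  -- `0`. The `+ 1` in `δ` covers `v = 0`.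
  set φ : ℝ → EuclideanSpace ℝ (Fin n) := fun t => u + (δ * Real.sin (δ⁻¹ * t)) • v with hφ
  have hφs : ContDiff ℝ ∞ φ := by fun_prop
  have hφU (t : ℝ) : φ t ∈ U := by
    refine hεU ?_
    rw [Metric.mem_ball, dist_eq_norm, hφ]
    simp only [add_sub_cancel_left]
    rw [norm_smul, norm_mul, Real.norm_of_nonneg hδ0.le]
    calc δ * ‖Real.sin (δ⁻¹ * t)‖ * ‖v‖ ≤ δ * 1 * ‖v‖ := by
          gcongr
          exact Real.abs_sin_le_one _
      _ < δ * 1 * (‖v‖ + 1) := by gcongr; linarith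
      _ = ε := by rw [hδ]; field_simp
  have hφv : HasDerivAt φ v 0 := by
    have h1 := ((hasDerivAt_id (0 : ℝ)).const_mul δ⁻¹).sin
    have h2 := ((h1.const_mul δ).smul_const v).const_add u
    convert! h2 using 1
    simp [hδ0.ne']
  refine ⟨fun t => p (φ t), fun m q hq => ?_,
    curveTangent_eq_mk _ hU hp hu v hφs hφU (fun _ => rfl) (by simp [hφ]) hφv⟩
  exact hp m (fun x => φ (q x)) (hφs.comp hq.contDiff) fun x => hφU _

end Tangent

end Diffeology

/-! ### Taylor expansion of curves and the map `ℓ` -/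

namespace Diffeology

variable {V : Type*} [AddCommGroup V] [Module ℝ V] [DiffeologicalSpace V]

theorem deriv_apply_of_isWeakDeriv {c d : ℝ → V} (h : IsWeakDeriv c d) {l : V →ₗ[ℝ] ℝ}
    (hl : l ∈ smoothDual V) : deriv (fun t => l (c t)) = fun t => l (d t) :=
  funext fun t => (h l hl t).deriv

/-- A twice weakly differentiable smooth curve has a first order Taylor expansion with smooth
remainder. -/
theorem IsPreConvenient.exists_taylor (hpre : IsPreConvenient V) (hsep : IsLinearlySeparated V)
    {c d₁ d₂ : ℝ → V} (hc : DSmooth c) (h₁ : IsWeakDeriv c d₁) (h₂ : IsWeakDeriv d₁ d₂) :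
    ∃ e : ℝ → V, DSmooth e ∧ ∀ t, c t = c 0 + t • d₁ 0 + t ^ 2 • e t := by
  classical
  -- The value at `0` is forced by continuity of each `l ∘ e`; this is where a second weak
  -- derivative is needed.
  let e : ℝ → V := fun t =>
    if t = 0 then (2 : ℝ)⁻¹ • d₂ 0 else (t ^ 2)⁻¹ • (c t - c 0 - t • d₁ 0)
  have he (l : V →ₗ[ℝ] ℝ) (hl : l ∈ smoothDual V) (t : ℝ) :
      l (e t) = dslope (dslope (fun s => l (c s)) 0) 0 t := by
    have hd := deriv_apply_of_isWeakDeriv h₁ hl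
    rcases eq_or_ne t 0 with rfl | ht
    · rw [dslope_dslope_zero_of_hasDerivAt (hc.contDiff_dual hl) (a := l (d₂ 0))
        (by rw [hd]; exact h₂ l hl 0)]
      simp [e]
    · have h := eq_add_mul_deriv_add_sq_mul_dslope_dslope (fun s => l (c s)) t
      rw [hd] at h
      simp only [e, ht, if_false, map_smul, map_sub, smul_eq_mul]
      field_simp
      linear_combination h
  refine ⟨e, hpre.dSmooth_of_forall fun l hl => ?_, fun t => hsep.eq_of_forall fun l hl => ?_⟩
  · rw [funext (he l hl)]
    exact (hc.contDiff_dual hl).dslope_zero.dslope_zero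
  · have h := eq_add_mul_deriv_add_sq_mul_dslope_dslope (fun s => l (c s)) t
    rw [deriv_apply_of_isWeakDeriv h₁ hl] at h
    simpa [he l hl] using h

section LineTangent

variable [DiffeologicalVectorSpace V]

theorem tangentMap_lineTangent {l : V →ₗ[ℝ] ℝ} (hl : l ∈ smoothDual V) (x : V × V) :
    tangentMap l hl (lineTangent V x) = (l x.1, l x.2) := by
  refine (tangentMap_mk_curve (f := l) hl (dSmooth_line x.1 x.2) 0).trans ?_
  simp

theorem dSmooth_lineTangent : DSmooth (lineTangent V) := by
  intro m q hq
  obtain ⟨hq1, hq2⟩ := hq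
  let e := toEuclidean (E := EuclideanSpace ℝ (Fin m) × ℝ)
  have he : ContDiff ℝ ∞ fun y => e.symm y := e.symm.contDiff
  have he' : ContDiff ℝ ∞ fun y => e y := e.contDiff
  -- The whole family of lines forms one plot `(r, s) ↦ u(r) + s v(r)`; its `s`-direction at `s = 0`
  -- gives `ℓ ∘ q`.
  let p : EuclideanSpace ℝ (Fin _) → V := fun y =>
    (q (e.symm y).1).1 + (e.symm y).2 • (q (e.symm y).1).2
  have hp : IsPlot p :=
    IsPlot.add (isPlot_reparam hq1 (contDiff_fst.comp he))
      (IsPlot.smul (contDiff_snd.comp he) (isPlot_reparam hq2 (contDiff_fst.comp he)))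
  refine DiffeologicalSpace.isPlot_generatedFrom_of_mem ⟨_, Set.univ, isOpen_univ, p,
    hp.isPlotOn _, fun r => e (r, 0), fun _ => e (0, 1), fun _ => Set.mem_univ _,
    he'.comp (contDiff_id.prodMk contDiff_const), contDiff_const, funext fun r => ?_⟩
  refine curveTangent_eq_mk (dSmooth_line (q r).1 (q r).2) isOpen_univ (hp.isPlotOn _) _ _
    (φ := fun t => e (r, t))
    (he'.comp (contDiff_const.prodMk contDiff_id)) (fun _ => Set.mem_univ _) ?_ rfl ?_
  · intro t
    simp [p]
  · exact e.hasFDerivAt.comp_hasDerivAt 0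
      ((hasDerivAt_const (0 : ℝ) r).prodMk (hasDerivAt_id (0 : ℝ)))

theorem curveTangent_eq_lineTangent {c e : ℝ → V} (hc : DSmooth c) (he : DSmooth e) {v : V}
    (h : ∀ t, c t = c 0 + t • v + t ^ 2 • e t) : curveTangent c hc = lineTangent V (c 0, v) := by
  let E := toEuclidean (E := ℝ × ℝ)
  have hE : ContDiff ℝ ∞ fun y => E.symm y := E.symm.contDiff
  have hE' : ContDiff ℝ ∞ fun y => E y := E.contDiff
  let p : EuclideanSpace ℝ (Fin _) → V := fun y =>
    (c 0 + (E.symm y).1 • v) + (E.symm y).2 • e (E.symm y).1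
  have hp : IsPlot p :=
    IsPlot.add (IsPlot.add isPlot_const (IsPlot.smul (contDiff_fst.comp hE) isPlot_const))
      (IsPlot.smul (contDiff_snd.comp hE)
        (he _ (fun y => (E.symm y).1) (contDiff_fst.comp hE).isPlot))
  -- The path `(t, a t)` has velocity `(1, 0)` whenever `a` vanishes to first order; used for `a =
  -- t²` and `a = 0`.
  have key {γ : ℝ → V} (hγ : DSmooth γ) {a : ℝ → ℝ} (ha : ContDiff ℝ ∞ a) (ha0 : a 0 = 0)
      (ha1 : HasDerivAt a 0 0) (hγa : ∀ t, γ t = c 0 + t • v + a t • e t) :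
      curveTangent γ hγ = DTangent.mk isOpen_univ (hp.isPlotOn _) (Set.mem_univ (E (0, 0)))
        (E (1, 0)) := by
    refine curveTangent_eq_mk _ _ _ _ _ (φ := fun t => E (t, a t))
      (hE'.comp (contDiff_id.prodMk ha)) (fun _ => Set.mem_univ _) ?_ (by simp [ha0]) ?_
    · intro t
      simp [p, hγa]
    · exact E.hasFDerivAt.comp_hasDerivAt 0 ((hasDerivAt_id (0 : ℝ)).prodMk ha1)
  exact (key hc (a := fun t => t ^ 2) (by fun_prop) (by simp)
    (by simpa using hasDerivAt_pow 2 (0 : ℝ)) h).trans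
    (key (dSmooth_line (c 0) v) (a := fun _ => 0) contDiff_const rfl (hasDerivAt_const _ _)
      (by simp)).symm

theorem lineTangent_injective (hsep : IsLinearlySeparated V) :
    Function.Injective (lineTangent V) := by
  intro x y hxy
  have h (l : V →ₗ[ℝ] ℝ) (hl : l ∈ smoothDual V) : (l x.1, l x.2) = (l y.1, l y.2) := by
    rw [← tangentMap_lineTangent hl, hxy, tangentMap_lineTangent hl]
  exact Prod.ext (hsep.eq_of_forall fun l hl => congrArg Prod.fst (h l hl))
    (hsep.eq_of_forall fun l hl => congrArg Prod.snd (h l hl))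

theorem IsConvenient.lineTangent_surjective (h : IsConvenient V) :
    Function.Surjective (lineTangent V) := by
  intro τ
  obtain ⟨c, hc, rfl⟩ := exists_curveTangent_eq τ
  obtain ⟨d, rfl, hd⟩ := h.2.2 c hc
  obtain ⟨e, he, hce⟩ := h.1.exists_taylor h.2.1 hc (hd 0) (hd 1)
  exact ⟨_, (curveTangent_eq_lineTangent hc he hce).symm⟩

theorem IsConvenient.isTangentStable (h : IsConvenient V) : IsTangentStable V := by
  obtain ⟨g, hgl, hgr⟩ := Function.bijective_iff_has_inverse.1
    ⟨lineTangent_injective h.2.1, h.lineTangent_surjective⟩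
  have hg {l : V →ₗ[ℝ] ℝ} (hl : l ∈ smoothDual V) (τ : DTangent V) :
      tangentMap l hl τ = (l (g τ).1, l (g τ).2) := by
    rw [← tangentMap_lineTangent hl, hgr]
  refine ⟨dSmooth_lineTangent, g, fun n q hq => ⟨?_, ?_⟩, hgl, hgr⟩
  · refine h.1.isPlot_iff.2 fun l hl => ?_
    simpa [hg hl, Function.comp_def] using (dSmooth_tangentMap_fst hl n q hq).contDiff
  · refine h.1.isPlot_iff.2 fun l hl => ?_
    simpa [hg hl, Function.comp_def] using (dSmooth_tangentMap_snd hl n q hq).contDiff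

theorem IsTangentStable.exists_isWeakDeriv (h : IsTangentStable V) {c : ℝ → V} (hc : DSmooth c) :
    ∃ d : ℝ → V, DSmooth d ∧ IsWeakDeriv c d := by
  obtain ⟨-, g, hg, -, hgr⟩ := h
  let τ : EuclideanSpace ℝ (Fin 1) → DTangent V := fun x =>
    DTangent.mk isOpen_univ (isPlotOn_curve hc) (Set.mem_univ x) (EuclideanSpace.single 0 1)
  have hτ : IsPlot τ :=
    DiffeologicalSpace.isPlot_generatedFrom_of_mem ⟨1, Set.univ, isOpen_univ, _,
      isPlotOn_curve hc, fun x => x, fun _ => EuclideanSpace.single 0 1, fun _ => Set.mem_univ _,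
      contDiff_id, contDiff_const, rfl⟩
  have hι : ContDiff ℝ ∞ fun t : ℝ => (EuclideanSpace.single 0 t : EuclideanSpace ℝ (Fin 1)) := by
    refine contDiff_euclidean.2 fun i => ?_
    obtain rfl := Subsingleton.elim 0 i
    simpa using contDiff_fun_id
  refine ⟨fun t => (g (τ (EuclideanSpace.single 0 t))).2, fun n p hp => ?_, fun l hl t => ?_⟩
  · exact isPlot_reparam (hg 1 τ hτ).2 (hι.comp hp.contDiff)
  · have h1 := tangentMap_mk_curve (f := l) hl hc (EuclideanSpace.single 0 t)
    have h2 := tangentMap_lineTangent hl (g (τ (EuclideanSpace.single 0 t)))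
    rw [hgr] at h2
    have h3 := congrArg Prod.snd (h2.symm.trans h1)
    simp only [PiLp.single_apply, if_true] at h3
    rw [h3]
    exact ((hc.contDiff_dual hl).differentiable (by simp) t).hasDerivAt

theorem IsTangentStable.isInfinitelyWeaklyDifferentiable (h : IsTangentStable V) {c : ℝ → V}
    (hc : DSmooth c) : IsInfinitelyWeaklyDifferentiable c := by
  -- Weak derivatives are chosen among smooth curves, so the choice can be iterated.
  choose D hD hD' using fun c : {c : ℝ → V // DSmooth c} => h.exists_isWeakDeriv c.2
  let d : ℕ → {c : ℝ → V // DSmooth c} := fun k => (fun c => ⟨D c, hD c⟩)^[k] ⟨c, hc⟩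
  refine ⟨fun k => (d k).1, rfl, fun k => ?_⟩
  simp only [d, Function.iterate_succ_apply']
  exact hD' _

end LineTangent

end Diffeology

theorem mainTheorem8 (V : Type*) [AddCommGroup V] [Module ℝ V] [DiffeologicalSpace V]
    [Diffeology.DiffeologicalVectorSpace V]
    (hpre : Diffeology.IsPreConvenient V) (hsep : Diffeology.IsLinearlySeparated V) :
    Diffeology.IsConvenient V ↔ Diffeology.IsTangentStable V :=
  ⟨fun h => h.isTangentStable,
    fun h => ⟨hpre, hsep, fun _ hc => h.isInfinitelyWeaklyDifferentiable hc⟩⟩
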